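/- Let $\mathsf H$ be a separable real Hilbert space, let $(\Omega,\mathcal F,\mathsf P)$ be a complete probability space, and let $\mathsf Z\subset\mathsf H$ be nonempty and closed. Write $L^p=L^p(\Omega,\mathcal F,\mathsf P;\mathsf H)$. For $\mathcal X\subset\mathcal F$ a sub-$\sigma$-algebra, $L^p(\Omega,\mathcal X,\mathsf P;\mathsf Z)$ is the set of classes of $\mathcal X$-measurable $p$-integrable $\mathsf H$-valued random variables lying a.s. in $\mathsf Z$. For a sequence in $\mathsf H$, $\mathfrak W$ and $\mathfrak S$ denote the sets of its weak and strong sequential cluster points. Let $\mathfrak C$ be the class of functions $\varphi\colon\Omega\times\mathsf H\to[0,+\infty[$ such that $\varphi(\omega,\cdot)$ is continuous for almost every $\omega$, $\varphi(\cdot,\mathsf x)$ is $\mathcal F$-measurable for every $\mathsf x\in\mathsf H$, and $\int_\Omega\varphi(\omega,x(\omega))\,\mathsf P(d\omega)<+\infty$ for every $x\in L^2$; put $\varphi(\cdot,x)\colon\omega\mapsto\varphi(\omega,x(\omega))$. Let $x_0\in L^2$ and suppose that, for every $n\in\mathbb N$, with $\mathcal X_n=\sigma(x_0,\dots,x_n)$,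 one has chosen $\lambda_n\in L^\infty(\Omega,\mathcal F,\mathsf P;\,]0,+\infty[)$, $d_n\in L^2$ and $\delta_n\in\mathfrak C$ such that $$\mathsf E\big(\lambda_n(2-\lambda_n)\|d_n\|^2\mid\mathcal X_n\big)\ge 0\ \text{ a.s.},\qquad(\forall \mathsf z\in \mathsf Z)\quad \mathsf E\big(\lambda_n\langle \mathsf z+d_n-x_n, d_n\rangle\mid\mathcal X_n\big)\le\delta_n(\cdot,\mathsf z)/2\ \text{ a.s.},$$ and set $x_{n+1}=x_n-\lambda_nd_n$. Then the following hold. (i) $(x_n)_{n\in\mathbb N}$ is a well-defined sequence in $L^2$ (in particular $\mathcal X_n\subset\mathcal F$ and the conditional expectations above are those of integrable random variables). (ii) For every $n\in\mathbb N$ and $\mathsf z\in\mathsf Z$, $$\mathsf E(\|x_{n+1}-\mathsf z\|^2\mid\mathcal X_n)\le\|x_n-\mathsf z\|^2-\mathsf E(\lambda_n(2-\lambda_n)\|d_n\|^2\mid\mathcal X_n)+\delta_n(\cdot,\mathsf z)\quad\text{a.s.}$$ (iii) For every $n\in\mathbb N$ and $z\in L^2(\Omega,\mathcal X_n,\mathsf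 P;\mathsf Z)$, $$\mathsf E(\|x_{n+1}-z\|^2\mid\mathcal X_n)\le\|x_n-z\|^2-\mathsf E(\lambda_n(2-\lambda_n)\|d_n\|^2\mid\mathcal X_n)+\delta_n(\cdot,z)\quad\text{a.s.}$$ (iv) For every $n\in\mathbb N$ and $z\in L^2(\Omega,\mathcal X_n,\mathsf P;\mathsf Z)$, $\delta_n(\cdot,z)$ is integrable and $$\|x_{n+1}-z\|_{L^2}^2\le\|x_n-z\|_{L^2}^2-\mathsf E(\lambda_n(2-\lambda_n)\|d_n\|^2)+\mathsf E\delta_n(\cdot,z).$$ (v) Suppose that, for every $\mathsf z\in\mathsf Z$, $\sum_n\delta_n(\cdot,\mathsf z)<+\infty$ a.s. Then: (a) $(\|x_n\|)_{n\in\mathbb N}$ is bounded a.s. (b) For every $\mathsf Z$-valued random variable $z$, $(\|x_n-z\|)_{n\in\mathbb N}$ converges a.s. (c) $\sum_n\mathsf E(\lambda_n(2-\lambda_n)\|d_n\|^2\mid\mathcal X_n)<+\infty$ a.s. (d) If $\mathfrak W(x_n)_{n\in\mathbb N}\subset\mathsf Z$ a.s., then $(x_n)_{n\in\mathbb N}$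 converges weakly a.s. to a $\mathsf Z$-valued random variable. (e) If $\mathfrak S(x_n)_{n\in\mathbb N}\cap\mathsf Z\ne\varnothing$ a.s., then $(x_n)_{n\in\mathbb N}$ converges strongly a.s. to a $\mathsf Z$-valued random variable. (f) If $\mathfrak S(x_n)_{n\in\mathbb N}\neq\varnothing$ a.s. and $\mathfrak W(x_n)_{n\in\mathbb N}\subset\mathsf Z$ a.s., then $(x_n)_{n\in\mathbb N}$ converges strongly a.s. to a $\mathsf Z$-valued random variable. (vi) Suppose that, for every $\mathsf z\in\mathsf Z$, $\sum_n\mathsf E\delta_n(\cdot,\mathsf z)<+\infty$. Then: (a) $(\|x_n\|_{L^2})_{n\in\mathbb N}$ is bounded. (b) For every $z\in L^2(\Omega,\mathcal F,\mathsf P;\mathsf Z)$, $(\|x_n-z\|_{L^1})_{n\in\mathbb N}$ converges. (c) $\sum_n\mathsf E(\lambda_n(2-\lambda_n)\|d_n\|^2)<+\infty$. (d) If $(x_n)_{n\in\mathbb N}$ converges weakly a.s. to an $\mathsf H$-valued random variable $x$, then $x\in L^2$ and $(x_n)_{n\in\mathbb N}$ converges weakly in $L^2$ to $x$. (e) Let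 $x$ be a $\mathsf Z$-valued random variable. Then $(x_n)_{n\in\mathbb N}$ converges strongly a.s. to $x$ if and only if it converges strongly in $L^1$ to $x$. In this case, $x\in L^2(\Omega,\mathcal F,\mathsf P;\mathsf Z)$ and $(x_n)_{n\in\mathbb N}$ converges weakly in $L^2$ to $x$. -/

import Mathlib

open MeasureTheory Filter Topology
open scoped ENNReal

/-- Weak convergence of a sequence in a real normed space: convergence for Mathlib's weak topology. -/
def WeaklyTendsto {E : Type*} [NormedAddCommGroup E] [NormedSpace ℝ E]
    (u : ℕ → E) (y : E) : Prop :=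
  Tendsto (fun n => toWeakSpace ℝ E (u n)) atTop (𝓝 (toWeakSpace ℝ E y))

/-- The set of weak sequential cluster points of a sequence. -/
def weakClusterPts {E : Type*} [NormedAddCommGroup E] [NormedSpace ℝ E] (u : ℕ → E) : Set E :=
  {y | ∃ k : ℕ → ℕ, StrictMono k ∧ WeaklyTendsto (fun n => u (k n)) y}

/-- The set of strong sequential cluster points of a sequence. -/
def strongClusterPts {E : Type*} [NormedAddCommGroup E] (u : ℕ → E) : Set E :=
  {y | ∃ k : ℕ → ℕ, StrictMono k ∧ Tendsto (fun n => u (k n)) atTop (𝓝 y)}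

/-- The sigma-algebra `σ(x₀, …, xₙ)` generated by the first `n + 1` terms of a sequence of
random variables. -/
@[reducible] def history {Ω H : Type*} [MeasurableSpace H] (x : ℕ → Ω → H) (n : ℕ) : MeasurableSpace Ω :=
  ⨆ j ≤ n, MeasurableSpace.comap (x j) inferInstance

/-- The class `ℭ(Ω, ℱ, P; H)` of nonnegative Carathéodory integrands `φ : Ω × H → [0, +∞[` such
that `∫ φ(ω, x(ω)) P(dω) < +∞` for every `x ∈ L²(Ω, ℱ, P; H)`. -/
structure IsCaratheodoryIntegrand {Ω H : Type*} [MeasurableSpace Ω] (μ : Measure Ω)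
    [NormedAddCommGroup H] (φ : Ω → H → ℝ) : Prop where
  nonneg : ∀ ω v, 0 ≤ φ ω v
  continuous : ∀ᵐ ω ∂μ, Continuous (φ ω)
  measurable : ∀ v, Measurable (fun ω => φ ω v)
  lintegral_lt_top : ∀ y : Ω → H, MemLp y 2 μ → ∫⁻ ω, ENNReal.ofReal (φ ω (y ω)) ∂μ < ⊤

/-- `x`, `lam`, `d`, `δ` are the iterates, relaxations, directions and tolerances of a run of the
abstract stochastic algorithm with target set `Z`. Elements of the Lebesgue spaces
are represented by functions, so that the recursion is required almost surely. -/
structure IsStochasticIteration {Ω H : Type*} [MeasurableSpace Ω] (μ : Measure Ω)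
    [NormedAddCommGroup H] [InnerProductSpace ℝ H] [MeasurableSpace H] (Z : Set H)
    (x : ℕ → Ω → H) (lam : ℕ → Ω → ℝ) (d : ℕ → Ω → H) (δ : ℕ → Ω → H → ℝ) : Prop where
  init : MemLp (x 0) 2 μ
  lam_memLp : ∀ n, MemLp (lam n) ∞ μ
  lam_pos : ∀ n, ∀ᵐ ω ∂μ, 0 < lam n ω
  d_memLp : ∀ n, MemLp (d n) 2 μ
  tolerance : ∀ n, IsCaratheodoryIntegrand μ (δ n)
  relax : ∀ n, ∀ᵐ ω ∂μ,
    0 ≤ (μ[fun ω' => lam n ω' * (2 - lam n ω') * ‖d n ω'‖ ^ 2 | history x n]) ω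
  cut : ∀ n, ∀ z ∈ Z, ∀ᵐ ω ∂μ,
    (μ[fun ω' => lam n ω' * inner ℝ (z + d n ω' - x n ω') (d n ω') | history x n]) ω
      ≤ δ n ω z / 2
  step : ∀ n, ∀ᵐ ω ∂μ, x (n + 1) ω = x n ω - lam n ω • d n ω

/-! Expanding the recursion gives `‖x (n+1) - z‖² = ‖x n - z‖² - λ(2 - λ)‖d‖² + 2λ⟪z + d - x n, d⟫`.
Conditioning on the history and bounding the last term by the cut hypothesis makes `‖x n - z‖²` an
almost supermartingale (`condExp_norm_sq_le`). For random `z` known at time `n`, the conditional cut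
term is affine in the value of `z`, so a countable dense subset of `Z` settles all values off a
single null set (`condExp_cut_le`).

If the tolerances are almost surely summable, Robbins–Siegmund makes the distance to each fixed
point of `Z` converge; separability and the 1-Lipschitz dependence on `z` give one null set for all
of `Z`. The rest of that regime is pathwise: Opial's lemma for weak limits, a cluster point in `Z`
for strong ones, and completeness of the measure for measurability of the limit.

If the expected tolerances are summable, almost sure summability follows, and telescoping the
integrated inequality bounds the iterates in `L²`. This bound gives uniform integrability, so Vitali
turns almost sure statements into `L¹` ones, while Fatou places the limits in `L²`. -/

/-! ### Weak and strong convergence of sequences in a Hilbert space. -/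

section Hilbert

variable {H : Type*} [NormedAddCommGroup H] [InnerProductSpace ℝ H]

/-- In a Hilbert space, weak convergence is convergence of all the inner products. -/
theorem weaklyTendsto_iff_forall_inner [CompleteSpace H] {u : ℕ → H} {y : H} :
    WeaklyTendsto u y ↔ ∀ v : H, Tendsto (fun n => inner ℝ v (u n)) atTop (𝓝 (inner ℝ v y)) := by
  have key : WeaklyTendsto u y ↔
      ∀ f : StrongDual ℝ H, Tendsto (fun n => f (u n)) atTop (𝓝 (f y)) := by
    refine WeakBilin.tendsto_iff_forall_eval_tendsto (topDualPairing ℝ H).flip ?_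
    intro a b hab
    refine ext_inner_left ℝ fun v => ?_
    exact DFunLike.congr_fun hab (InnerProductSpace.toDual ℝ H v)
  rw [key]
  refine ⟨fun h v => by simpa using h (InnerProductSpace.toDual ℝ H v), fun h f => ?_⟩
  simpa using h ((InnerProductSpace.toDual ℝ H).symm f)

theorem WeaklyTendsto.unique [CompleteSpace H] {u : ℕ → H} {y z : H}
    (hy : WeaklyTendsto u y) (hz : WeaklyTendsto u z) : y = z := by
  rw [weaklyTendsto_iff_forall_inner] at hy hz
  exact ext_inner_left ℝ fun v => tendsto_nhds_unique (hy v) (hz v)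

theorem Filter.Tendsto.weaklyTendsto [CompleteSpace H] {u : ℕ → H} {y : H}
    (h : Tendsto u atTop (𝓝 y)) : WeaklyTendsto u y :=
  weaklyTendsto_iff_forall_inner.2 fun _ => tendsto_const_nhds.inner h

/-- A bounded sequence of a separable Hilbert space has a weakly convergent subsequence. -/
theorem exists_strictMono_weaklyTendsto [CompleteSpace H] [TopologicalSpace.SeparableSpace H]
    {u : ℕ → H} {C : ℝ} (hu : ∀ n, ‖u n‖ ≤ C) :
    ∃ y, ∃ k : ℕ → ℕ, StrictMono k ∧ WeaklyTendsto (fun n => u (k n)) y := by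
  have hmem : ∀ n, StrongDual.toWeakDual (InnerProductSpace.toDual ℝ H (u n)) ∈
      WeakDual.toStrongDual ⁻¹' Metric.closedBall (0 : StrongDual ℝ H) C := by
    intro n
    rw [Set.mem_preimage, StrongDual.toStrongDual_toWeakDual, mem_closedBall_zero_iff]
    simpa using hu n
  obtain ⟨f, -, k, hk, hf⟩ := WeakDual.isSeqCompact_closedBall ℝ H 0 C hmem
  refine ⟨(InnerProductSpace.toDual ℝ H).symm (WeakDual.toStrongDual f), k, hk, ?_⟩
  rw [weaklyTendsto_iff_forall_inner]
  intro v
  have h1 := ((WeakDual.eval_continuous v).tendsto f).comp hf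
  have h2 : inner ℝ v ((InnerProductSpace.toDual ℝ H).symm (WeakDual.toStrongDual f)) = f v := by
    rw [real_inner_comm, InnerProductSpace.toDual_symm_apply, WeakDual.toStrongDual_apply]
  rw [h2]
  refine h1.congr fun n => ?_
  simp [real_inner_comm]

/-- **Opial's lemma** for sequences whose distances to the points of a set all converge. -/
theorem exists_weaklyTendsto_of_weakClusterPts_subset [CompleteSpace H]
    [TopologicalSpace.SeparableSpace H] {Z : Set H} {u : ℕ → H} {C : ℝ} (hu : ∀ n, ‖u n‖ ≤ C)
    (hconv : ∀ z ∈ Z, ∃ l : ℝ, Tendsto (fun n => ‖u n - z‖) atTop (𝓝 l))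
    (hcl : weakClusterPts u ⊆ Z) : ∃ y ∈ Z, WeaklyTendsto u y := by
  obtain ⟨y, k, hk, hy⟩ := exists_strictMono_weaklyTendsto hu
  have hyZ : y ∈ Z := hcl ⟨k, hk, hy⟩
  refine ⟨y, hyZ, weaklyTendsto_iff_forall_inner.2 fun v => ?_⟩
  refine tendsto_of_subseq_tendsto fun ns hns => ?_
  obtain ⟨φ, hφ, hnφ⟩ := strictMono_subseq_of_tendsto_atTop hns
  obtain ⟨y', m, hm, hy'⟩ := exists_strictMono_weaklyTendsto (u := fun n => u (ns (φ n)))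
    (fun n => hu _)
  have hk' : StrictMono fun n => ns (φ (m n)) := hnφ.comp hm
  have hyZ' : y' ∈ Z := hcl ⟨_, hk', hy'⟩
  obtain ⟨l, hl⟩ := hconv y hyZ
  obtain ⟨l', hl'⟩ := hconv y' hyZ'
  -- Polarization: `2⟪y - y', u⟫ = ‖u - y'‖² - ‖u - y‖² + ‖y‖² - ‖y'‖²`, whose right side converges
  -- along the full sequence. Comparing the limits along the two subsequences then forces `y = y'`.
  have hlim : Tendsto (fun n => inner ℝ (y - y') (u n)) atTop
      (𝓝 ((l' ^ 2 - l ^ 2 + ‖y‖ ^ 2 - ‖y'‖ ^ 2) / 2)) := by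
    refine (((((hl'.pow 2).sub (hl.pow 2)).add_const (‖y‖ ^ 2)).sub_const
      (‖y'‖ ^ 2)).div_const 2).congr fun n => ?_
    rw [norm_sub_sq_real, norm_sub_sq_real, inner_sub_left, real_inner_comm y, real_inner_comm y']
    ring
  have e1 := tendsto_nhds_unique (weaklyTendsto_iff_forall_inner.1 hy (y - y'))
    (hlim.comp hk.tendsto_atTop)
  have e2 := tendsto_nhds_unique (weaklyTendsto_iff_forall_inner.1 hy' (y - y'))
    (hlim.comp hk'.tendsto_atTop)
  have e3 : inner ℝ (y - y') (y - y') = 0 := by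
    rw [inner_sub_right, e1, e2, sub_self]
  have e4 : y = y' := sub_eq_zero.1 (inner_self_eq_zero.1 e3)
  refine ⟨fun n => φ (m n), ?_⟩
  rw [e4]
  exact weaklyTendsto_iff_forall_inner.1 hy' v

/-- The norm is weakly sequentially lower semicontinuous. -/
theorem WeaklyTendsto.enorm_le_liminf [CompleteSpace H] {u : ℕ → H} {y : H}
    (h : WeaklyTendsto u y) : ‖y‖ₑ ≤ liminf (fun n => ‖u n‖ₑ) atTop := by
  rcases eq_or_ne y 0 with rfl | hy
  · simp
  have hy' : 0 < ‖y‖ := norm_pos_iff.2 hy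
  -- Test against the unit vector `y / ‖y‖`, where Cauchy–Schwarz is an equality in the limit.
  have h1 : Tendsto (fun n => ENNReal.ofReal (inner ℝ y (u n) / ‖y‖)) atTop
      (𝓝 (ENNReal.ofReal (inner ℝ y y / ‖y‖))) :=
    ENNReal.tendsto_ofReal ((weaklyTendsto_iff_forall_inner.1 h y).div_const _)
  have h2 : ENNReal.ofReal (inner ℝ y y / ‖y‖) = ‖y‖ₑ := by
    rw [real_inner_self_eq_norm_sq, sq, mul_div_cancel_right₀ _ hy'.ne', ofReal_norm]
  rw [← h2, ← h1.liminf_eq]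
  refine liminf_le_liminf (Eventually.of_forall fun n => ?_)
  rw [← ofReal_norm]
  refine ENNReal.ofReal_le_ofReal ?_
  rw [div_le_iff₀ hy', mul_comm]
  exact real_inner_le_norm _ _

/-- Convergence of the distances extends from a set to its closure. -/
theorem exists_tendsto_norm_sub_of_mem_closure {E : Type*} [NormedAddCommGroup E] {D : Set E}
    {u : ℕ → E} (h : ∀ z ∈ D, ∃ l : ℝ, Tendsto (fun n => ‖u n - z‖) atTop (𝓝 l))
    {z : E} (hz : z ∈ closure D) : ∃ l : ℝ, Tendsto (fun n => ‖u n - z‖) atTop (𝓝 l) := by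
  refine cauchySeq_tendsto_of_complete (Metric.cauchySeq_iff'.2 fun ε hε => ?_)
  obtain ⟨w, hwD, hw⟩ := Metric.mem_closure_iff.1 hz (ε / 3) (by positivity)
  obtain ⟨l, hl⟩ := h w hwD
  obtain ⟨N, hN⟩ := Metric.cauchySeq_iff'.1 hl.cauchySeq (ε / 3) (by positivity)
  refine ⟨N, fun n hn => ?_⟩
  have h1 := hN n hn
  rw [Real.dist_eq] at h1 ⊢
  rw [dist_eq_norm] at hw
  have key : ∀ m, |‖u m - z‖ - ‖u m - w‖| < ε / 3 := fun m => by
    refine (abs_norm_sub_norm_le _ _).trans_lt ?_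
    rwa [sub_sub_sub_cancel_left, norm_sub_rev]
  have h2 := abs_lt.1 (key n)
  have h3 := abs_lt.1 (key N)
  have h4 := abs_lt.1 h1
  rw [abs_lt]
  constructor <;> linarith [h2.1, h2.2, h3.1, h3.2, h4.1, h4.2]

/-- If the distances to a strong cluster point converge, then the sequence converges. -/
theorem tendsto_of_mem_strongClusterPts {E : Type*} [NormedAddCommGroup E] {u : ℕ → E} {z : E}
    (hz : z ∈ strongClusterPts u) (h : ∃ l : ℝ, Tendsto (fun n => ‖u n - z‖) atTop (𝓝 l)) :
    Tendsto u atTop (𝓝 z) := by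
  obtain ⟨k, hk, hkz⟩ := hz
  obtain ⟨l, hl⟩ := h
  have h0 : l = 0 := tendsto_nhds_unique (hl.comp hk.tendsto_atTop)
    (tendsto_iff_norm_sub_tendsto_zero.1 hkz)
  exact tendsto_iff_norm_sub_tendsto_zero.2 (h0 ▸ hl)

/-- A weakly measurable function with values in a separable Hilbert space is measurable. -/
theorem measurable_of_forall_inner [CompleteSpace H] {Ω : Type*} [MeasurableSpace Ω]
    [TopologicalSpace.SeparableSpace H] [MeasurableSpace H] [BorelSpace H] {y : Ω → H}
    (h : ∀ v : H, Measurable fun ω => inner ℝ v (y ω)) : Measurable y := by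
  have := UniformSpace.secondCountable_of_separable H
  -- Pairing with a dense sequence is a continuous injection of a Polish space into `ℕ → ℝ`, hence a
  -- measurable embedding by Lusin–Souslin; measurability can be tested after it.
  let Φ : H → ℕ → ℝ := fun w n => inner ℝ (TopologicalSpace.denseSeq H n) w
  have hcont : Continuous Φ := by fun_prop
  have hinj : Function.Injective Φ := by
    intro a b hab
    refine ext_inner_left ℝ fun v => ?_
    have hcl : IsClosed {v : H | (inner ℝ v a : ℝ) = inner ℝ v b} :=
      isClosed_eq (by fun_prop) (by fun_prop)
    refine hcl.closure_subset_iff.2 ?_ (TopologicalSpace.denseRange_denseSeq H v)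
    rintro _ ⟨n, rfl⟩
    exact congrFun hab n
  exact (hcont.measurableEmbedding hinj).measurable_comp_iff.1 (measurable_pi_iff.2 fun n => h _)

end Hilbert

/-! ### Fatou and Vitali arguments for `L²`-bounded sequences. -/

section Integration

variable {Ω : Type*} {mΩ : MeasurableSpace Ω} {μ : Measure Ω}

/-- A sequence of nonnegative functions with summable integrals is summable almost surely. -/
theorem ae_summable_of_summable_integral {f : ℕ → Ω → ℝ} (hf : ∀ n, Integrable (f n) μ)
    (hnn : ∀ n, 0 ≤ᵐ[μ] f n) (hsum : Summable fun n => ∫ ω, f n ω ∂μ) :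
    ∀ᵐ ω ∂μ, Summable fun n => f n ω := by
  have hlt : ∫⁻ ω, ∑' n, ENNReal.ofReal (f n ω) ∂μ < ∞ := by
    rw [lintegral_tsum fun n => (hf n).aemeasurable.ennreal_ofReal]
    simp_rw [← ofReal_integral_eq_lintegral_ofReal (hf _) (hnn _)]
    exact hsum.tsum_ofReal_lt_top
  filter_upwards [ae_lt_top' (AEMeasurable.tsum fun n =>
    (hf n).aemeasurable.ennreal_ofReal) hlt.ne, ae_all_iff.2 hnn] with ω h1 h2
  refine (ENNReal.summable_toReal h1.ne).congr fun n => ?_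
  exact ENNReal.toReal_ofReal (h2 n)

/-- A sequence dominated by the products of an `L²`-bounded sequence with a fixed
square-integrable function is uniformly integrable. -/
theorem unifIntegrable_one_of_norm_le_mul {E F : Type*} [NormedAddCommGroup E]
    [NormedAddCommGroup F] {f : ℕ → Ω → E} {x : ℕ → Ω → F} {g : Ω → ℝ} {C : ℝ}
    (hx : ∀ n, AEStronglyMeasurable (x n) μ) (hC : ∀ n, eLpNorm (x n) 2 μ ≤ ENNReal.ofReal C)
    (hg : MemLp g 2 μ) (hle : ∀ n, ∀ᵐ ω ∂μ, ‖f n ω‖ ≤ ‖x n ω‖ * ‖g ω‖) :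
    UnifIntegrable f 1 μ := by
  intro ε hε
  -- `C` may be zero or negative; the maximum keeps the divisor positive.
  have hC' : 0 < max C 1 := by positivity
  obtain ⟨δ, hδ, h⟩ := unifIntegrable_const (ι := Unit) (p := 2) one_le_two ENNReal.ofNat_ne_top hg
    (div_pos hε hC')
  refine ⟨δ, hδ, fun n s hs hμs => ?_⟩
  have h1 : eLpNorm (s.indicator (f n)) 1 μ ≤
      eLpNorm (fun ω => ‖x n ω‖ * s.indicator g ω) 1 μ := by
    refine eLpNorm_mono_ae ?_
    filter_upwards [hle n] with ω hω
    by_cases hmem : ω ∈ s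
    · simpa [hmem] using hω
    · simp [hmem]
  have h2 : eLpNorm (fun ω => ‖x n ω‖ * s.indicator g ω) 1 μ ≤
      eLpNorm (fun ω => ‖x n ω‖) 2 μ * eLpNorm (s.indicator g) 2 μ :=
    by
    have := eLpNorm_smul_le_mul_eLpNorm (p := 2) (q := 2) (r := 1) (f := s.indicator g)
      (φ := fun ω => ‖x n ω‖) (hg.1.indicator hs) (hx n).norm
    exact this
  refine (h1.trans h2).trans ?_
  rw [eLpNorm_norm]
  calc eLpNorm (x n) 2 μ * eLpNorm (s.indicator g) 2 μ
      ≤ ENNReal.ofReal (max C 1) * ENNReal.ofReal (ε / max C 1) := by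
        gcongr
        · exact (hC n).trans (ENNReal.ofReal_le_ofReal (le_max_left _ _))
        · exact h () s hs hμs
    _ = ENNReal.ofReal ε := by
        rw [← ENNReal.ofReal_mul hC'.le, mul_div_cancel₀ _ hC'.ne']

/-- Vitali convergence for real sequences dominated by products of an `L²`-bounded sequence and a
square-integrable function. -/
theorem tendsto_integral_of_norm_le_mul [IsProbabilityMeasure μ] {F : Type*}
    [NormedAddCommGroup F] {f : ℕ → Ω → ℝ} {h : Ω → ℝ} {x : ℕ → Ω → F} {g : Ω → ℝ} {C : ℝ}
    (hx : ∀ n, AEStronglyMeasurable (x n) μ) (hC : ∀ n, eLpNorm (x n) 2 μ ≤ ENNReal.ofReal C)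
    (hg : MemLp g 2 μ) (hle : ∀ n, ∀ᵐ ω ∂μ, ‖f n ω‖ ≤ ‖x n ω‖ * ‖g ω‖)
    (hf : ∀ n, Integrable (f n) μ) (hh : Integrable h μ)
    (hlim : ∀ᵐ ω ∂μ, Tendsto (fun n => f n ω) atTop (𝓝 (h ω))) :
    Tendsto (fun n => ∫ ω, f n ω ∂μ) atTop (𝓝 (∫ ω, h ω ∂μ)) :=
  tendsto_integral_of_L1' h hh.1 (Eventually.of_forall hf)
    (tendsto_Lp_finite_of_tendsto_ae le_rfl ENNReal.one_ne_top (fun n => (hf n).1)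
      (memLp_one_iff_integrable.2 hh) (unifIntegrable_one_of_norm_le_mul hx hC hg hle) hlim)

/-- An almost sure limit, in the sense of `‖y‖ₑ ≤ liminf ‖x n‖ₑ`, of an `L²`-bounded sequence is
square-integrable. -/
theorem memLp_two_of_enorm_le_liminf {E : Type*} [NormedAddCommGroup E] {x : ℕ → Ω → E}
    {y : Ω → E} {C : ℝ} (hx : ∀ n, AEStronglyMeasurable (x n) μ)
    (hC : ∀ n, eLpNorm (x n) 2 μ ≤ ENNReal.ofReal C) (hy : AEStronglyMeasurable y μ)
    (hle : ∀ᵐ ω ∂μ, ‖y ω‖ₑ ≤ liminf (fun n => ‖x n ω‖ₑ) atTop) : MemLp y 2 μ := by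
  refine ⟨hy, ?_⟩
  rw [eLpNorm_lt_top_iff_lintegral_rpow_enorm_lt_top (by norm_num) (by norm_num)]
  have hmono : Monotone fun t : ℝ≥0∞ => t ^ (2 : ℝ≥0∞).toReal :=
    ENNReal.monotone_rpow_of_nonneg (by norm_num)
  calc ∫⁻ ω, ‖y ω‖ₑ ^ (2 : ℝ≥0∞).toReal ∂μ
      ≤ ∫⁻ ω, liminf (fun n => ‖x n ω‖ₑ ^ (2 : ℝ≥0∞).toReal) atTop ∂μ := by
        refine lintegral_mono_ae ?_
        filter_upwards [hle] with ω hω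
        refine (hmono hω).trans_eq ?_
        exact hmono.map_liminf_of_continuousAt _ ENNReal.continuous_rpow_const.continuousAt
    _ ≤ liminf (fun n => ∫⁻ ω, ‖x n ω‖ₑ ^ (2 : ℝ≥0∞).toReal ∂μ) atTop :=
        lintegral_liminf_le' fun n => (hx n).enorm.pow_const _
    _ ≤ ENNReal.ofReal C ^ (2 : ℝ≥0∞).toReal := by
        refine liminf_le_of_le (by isBoundedDefault) fun b hb => ?_
        obtain ⟨n, hn⟩ := hb.exists
        refine hn.trans ?_
        refine le_trans (le_of_eq ?_) (hmono (hC n))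
        simp only
        rw [eLpNorm_eq_lintegral_rpow_enorm_toReal (by norm_num) (by norm_num),
          ← ENNReal.rpow_mul]
        norm_num
    _ < ∞ := ENNReal.rpow_lt_top_of_nonneg (by norm_num) ENNReal.ofReal_ne_top

theorem sq_toReal_eLpNorm_two {E : Type*} [NormedAddCommGroup E] {f : Ω → E}
    (hf : MemLp f 2 μ) : (eLpNorm f 2 μ).toReal ^ 2 = ∫ ω, ‖f ω‖ ^ 2 ∂μ := by
  rw [hf.eLpNorm_eq_integral_rpow_norm (by norm_num) (by norm_num), ENNReal.toReal_ofReal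
    (by positivity), ← Real.rpow_natCast, ← Real.rpow_mul (by positivity)]
  norm_num

theorem MeasureTheory.MemLp.integrable_inner {H : Type*} [NormedAddCommGroup H]
    [InnerProductSpace ℝ H] {f g : Ω → H} (hf : MemLp f 2 μ) (hg : MemLp g 2 μ) :
    Integrable (fun ω => (inner ℝ (f ω) (g ω) : ℝ)) μ := by
  refine ((MemLp.integrable_mul hf.norm hg.norm :)).mono (hf.1.inner hg.1) ?_
  filter_upwards with ω
  simpa using abs_real_inner_le_norm (f ω) (g ω)

theorem integrable_norm_sq {E : Type*} [NormedAddCommGroup E] {f : Ω → E} (hf : MemLp f 2 μ) :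
    Integrable (fun ω => ‖f ω‖ ^ 2) μ :=
  (memLp_two_iff_integrable_sq_norm hf.1).1 hf

/-- In `L²`, weak convergence follows from almost sure weak convergence and boundedness. -/
theorem exists_memLp_weaklyTendsto_toLp [IsProbabilityMeasure μ] {H : Type*}
    [NormedAddCommGroup H] [InnerProductSpace ℝ H] [CompleteSpace H] {x : ℕ → Ω → H} {y : Ω → H}
    {C : ℝ} (hx : ∀ n, MemLp (x n) 2 μ) (hC : ∀ n, eLpNorm (x n) 2 μ ≤ ENNReal.ofReal C)
    (hy : AEStronglyMeasurable y μ) (hlim : ∀ᵐ ω ∂μ, WeaklyTendsto (fun n => x n ω) (y ω)) :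
    ∃ hy : MemLp y 2 μ, WeaklyTendsto (fun n => (hx n).toLp (x n)) (hy.toLp y) := by
  have hy2 : MemLp y 2 μ := memLp_two_of_enorm_le_liminf (fun n => (hx n).1) hC hy
    (hlim.mono fun ω hω => hω.enorm_le_liminf)
  refine ⟨hy2, weaklyTendsto_iff_forall_inner.2 fun v => ?_⟩
  have hv := Lp.memLp v
  have hinner : ∀ {w : Ω → H} (hw : MemLp w 2 μ),
      inner ℝ v (hw.toLp w) = ∫ ω, (inner ℝ (v ω) (w ω) : ℝ) ∂μ := by
    intro w hw
    rw [L2.inner_def]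
    refine integral_congr_ae ?_
    filter_upwards [hw.coeFn_toLp] with ω hω
    rw [hω]
  simp_rw [hinner]
  refine tendsto_integral_of_norm_le_mul (fun n => (hx n).1) hC hv.norm
    (fun n => Eventually.of_forall fun ω => ?_) (fun n => hv.integrable_inner (hx n))
    (hv.integrable_inner hy2) ?_
  · rw [norm_norm, mul_comm]
    exact norm_inner_le_norm _ _
  · filter_upwards [hlim] with ω hω
    exact weaklyTendsto_iff_forall_inner.1 hω _

end Integration

/-! ### Convergence of almost supermartingales. -/

section RobbinsSiegmund

variable {Ω : Type*} {mΩ : MeasurableSpace Ω} {μ : Measure Ω}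

/-- **Robbins–Siegmund theorem** for almost supermartingales. -/
theorem ae_tendsto_and_summable_of_condExp_le [IsProbabilityMeasure μ] (ℱ : Filtration ℕ mΩ)
    {V θ ε : ℕ → Ω → ℝ} (hVm : ∀ n, StronglyMeasurable[ℱ n] (V n))
    (hVi : ∀ n, Integrable (V n) μ) (hV0 : ∀ n ω, 0 ≤ V n ω)
    (hθi : ∀ n, Integrable (θ n) μ)
    (hθ0 : ∀ n, 0 ≤ᵐ[μ] θ n)
    (hεm : ∀ n, StronglyMeasurable[ℱ n] (ε n)) (hε0 : ∀ n ω, 0 ≤ ε n ω)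
    (h : ∀ n, ∀ᵐ ω ∂μ, (μ[V (n + 1) | ℱ n]) ω ≤ V n ω - θ n ω + ε n ω)
    (hsum : ∀ᵐ ω ∂μ, Summable fun n => ε n ω) :
    ∀ᵐ ω ∂μ, (∃ l : ℝ, Tendsto (fun n => V n ω) atTop (𝓝 l)) ∧ Summable fun n => θ n ω := by
  set S : ℕ → Ω → ℝ := fun n ω => ∑ k ∈ Finset.range n, ε k ω with hS
  have hS0 : ∀ n ω, 0 ≤ S n ω := fun n ω => Finset.sum_nonneg fun k _ => hε0 k ω
  have hSm' : ∀ n, StronglyMeasurable[ℱ n] (S (n + 1)) := fun n =>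
    Finset.stronglyMeasurable_fun_sum _ fun k hk =>
      (hεm k).mono (ℱ.mono (Finset.mem_range_succ_iff.1 hk))
  have hSm : ∀ n, StronglyMeasurable[ℱ n] (S n) := fun n =>
    Finset.stronglyMeasurable_fun_sum _ fun k hk =>
      (hεm k).mono (ℱ.mono (Finset.mem_range.1 hk).le)
  -- Discount factor absorbing the errors. It lies in `]0, 1]`, so no integrability of `ε` is
  -- needed, and `e (n + 1)` involves only `ε 0, …, ε n`, so it is already known at time `n` and can
  -- be pulled out of the conditional expectation.
  set e : ℕ → Ω → ℝ := fun n ω => Real.exp (-S n ω) with he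
  have hem : ∀ n, StronglyMeasurable[ℱ n] (e n) := fun n =>
    Real.continuous_exp.comp_stronglyMeasurable (hSm n).neg
  have hem' : ∀ n, StronglyMeasurable[ℱ n] (e (n + 1)) := fun n =>
    Real.continuous_exp.comp_stronglyMeasurable (hSm' n).neg
  have he1 : ∀ n ω, ‖e n ω‖ ≤ 1 := fun n ω => by
    rw [Real.norm_eq_abs, Real.abs_exp]
    exact Real.exp_le_one_iff.2 (neg_nonpos.2 (hS0 n ω))
  have hmul : ∀ n {g : Ω → ℝ}, Integrable g μ → Integrable (fun ω => e n ω * g ω) μ :=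
    fun n g hg => hg.bdd_mul (((hem n).mono (ℱ.le n)).aestronglyMeasurable)
      (Eventually.of_forall (he1 n))
  -- The added `1` turns the additive error into a multiplicative one: `V + 1 + ε ≤ (1 + ε)(V + 1) ≤
  -- exp ε * (V + 1)`. Hence `W` is a nonnegative supermartingale.
  set W : ℕ → Ω → ℝ := fun n ω => e n ω * (V n ω + 1) with hW
  have hVi1 : ∀ n, Integrable (fun ω => V n ω + 1) μ := fun n => (hVi n).add (integrable_const 1)
  have hWi : ∀ n, Integrable (W n) μ := fun n => hmul n (hVi1 n)
  have hW0 : ∀ n ω, 0 ≤ W n ω := fun n ω =>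
    mul_nonneg (Real.exp_pos _).le (add_nonneg (hV0 n ω) zero_le_one)
  have hTi : ∀ n, Integrable (fun ω => e (n + 1) ω * θ n ω) μ := fun n => hmul _ (hθi n)
  have hT0 : ∀ n, 0 ≤ᵐ[μ] fun ω => e (n + 1) ω * θ n ω := fun n => by
    filter_upwards [hθ0 n] with ω hω using mul_nonneg (Real.exp_pos _).le hω
  have hcond : ∀ n, ∀ᵐ ω ∂μ, (μ[W (n + 1) | ℱ n]) ω ≤ W n ω - e (n + 1) ω * θ n ω := by
    intro n
    have h1 : μ[W (n + 1) | ℱ n] =ᵐ[μ] e (n + 1) * μ[fun ω => V (n + 1) ω + 1 | ℱ n] :=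
      condExp_mul_of_stronglyMeasurable_left (hem' n) (hWi (n + 1)) (hVi1 (n + 1))
    have h2 : μ[fun ω => V (n + 1) ω + 1 | ℱ n] =ᵐ[μ]
        μ[V (n + 1) | ℱ n] + μ[fun _ => (1 : ℝ) | ℱ n] :=
      condExp_add (hVi (n + 1)) (integrable_const 1) _
    rw [condExp_const (ℱ.le n)] at h2
    filter_upwards [h1, h2, h n] with ω h1 h2 h3
    rw [h1, Pi.mul_apply, h2, Pi.add_apply]
    have hexp : e (n + 1) ω * (V n ω + 1 + ε n ω) ≤ e n ω * (V n ω + 1) := by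
      have hsplit : e n ω = e (n + 1) ω * Real.exp (ε n ω) := by
        simp only [he, hS]
        rw [← Real.exp_add, Finset.sum_range_succ]
        congr 1
        ring
      rw [hsplit, mul_assoc]
      refine mul_le_mul_of_nonneg_left ?_ (Real.exp_pos _).le
      have := mul_le_mul_of_nonneg_right (Real.add_one_le_exp (ε n ω))
        (add_nonneg (hV0 n ω) zero_le_one)
      nlinarith [mul_nonneg (hε0 n ω) (hV0 n ω)]
    have h4 := mul_le_mul_of_nonneg_left (add_le_add_left h3 1)
      (Real.exp_pos (-S (n + 1) ω)).le
    calc e (n + 1) ω * ((μ[V (n + 1) | ℱ n]) ω + 1)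
        ≤ e (n + 1) ω * (V n ω - θ n ω + ε n ω + 1) := h4
      _ = e (n + 1) ω * (V n ω + 1 + ε n ω) - e (n + 1) ω * θ n ω := by ring
      _ ≤ W n ω - e (n + 1) ω * θ n ω := by gcongr
  have hint : ∀ n, ∫ ω, e (n + 1) ω * θ n ω ∂μ ≤ ∫ ω, W n ω ∂μ - ∫ ω, W (n + 1) ω ∂μ := by
    intro n
    have := integral_mono_ae integrable_condExp ((hWi n).sub (hTi n)) (hcond n)
    rw [integral_condExp (ℱ.le n)] at this
    simp only [Pi.sub_apply] at this
    rw [integral_sub (hWi n) (hTi n)] at this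
    linarith
  have hIT0 : ∀ n, 0 ≤ ∫ ω, e (n + 1) ω * θ n ω ∂μ := fun n => integral_nonneg_of_ae (hT0 n)
  have hsumT : ∀ᵐ ω ∂μ, Summable fun n => e (n + 1) ω * θ n ω := by
    refine ae_summable_of_summable_integral hTi hT0
      (summable_of_sum_range_le (c := ∫ ω, W 0 ω ∂μ) hIT0 fun n => ?_)
    refine (Finset.sum_le_sum fun i _ => hint i).trans ?_
    rw [Finset.sum_range_sub' fun n => ∫ ω, W n ω ∂μ]
    have := integral_nonneg (μ := μ) (f := W n) fun ω => hW0 n ω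
    linarith
  have hsup : Supermartingale W ℱ μ := by
    refine supermartingale_nat (fun n => (hem n).mul ((hVm n).add stronglyMeasurable_const)) hWi
      fun n => ?_
    filter_upwards [hcond n, hT0 n] with ω h1 h2
    have h2' : 0 ≤ e (n + 1) ω * θ n ω := h2
    linarith
  have hbdd : ∀ n, eLpNorm ((-W) n) 1 μ ≤ (Real.toNNReal (∫ ω, W 0 ω ∂μ) : ℝ≥0∞) := by
    intro n
    rw [Pi.neg_apply, eLpNorm_neg, eLpNorm_one_eq_lintegral_enorm,
      ← ofReal_integral_norm_eq_lintegral_enorm (hWi n)]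
    simp_rw [Real.norm_of_nonneg (hW0 n _)]
    exact ENNReal.ofReal_le_ofReal
      (antitone_nat_of_succ_le (f := fun n => ∫ ω, W n ω ∂μ)
        (fun n => by linarith [hint n, hIT0 n]) (Nat.zero_le n))
  filter_upwards [hsup.neg.exists_ae_tendsto_of_bdd hbdd, hsumT, hsum, ae_all_iff.2 hθ0]
    with ω ⟨l, hl⟩ hT hε hθ
  -- Where `∑ ε` is finite, the discount stays above `exp (-∑ ε) > 0`, so it can be divided out of
  -- both conclusions.
  have hSlim : Tendsto (fun n => S n ω) atTop (𝓝 (∑' n, ε n ω)) := hε.hasSum.tendsto_sum_nat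
  have hSle : ∀ n, S n ω ≤ ∑' n, ε n ω := fun n => hε.sum_le_tsum _ fun k _ => hε0 k ω
  constructor
  · refine ⟨Real.exp (∑' n, ε n ω) * -l - 1, ?_⟩
    refine (((Real.continuous_exp.tendsto _).comp hSlim).mul hl.neg |>.sub_const 1).congr
      fun n => ?_
    simp only [Function.comp_apply, Pi.neg_apply, neg_neg, hW, he]
    rw [← mul_assoc, ← Real.exp_add]
    simp
  · refine Summable.of_nonneg_of_le hθ (fun n => ?_) (hT.mul_left (Real.exp (∑' n, ε n ω)))
    rw [← mul_assoc, ← Real.exp_add]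
    exact le_mul_of_one_le_left (hθ n) (Real.one_le_exp (by linarith [hSle (n + 1)]))

end RobbinsSiegmund

/-! ### Histories, integrability and the conditional cut inequality. -/

section Iteration

variable {Ω : Type*} {mΩ : MeasurableSpace Ω} {μ : Measure Ω} {H : Type*}

theorem stronglyMeasurable_history [TopologicalSpace H] [TopologicalSpace.PseudoMetrizableSpace H]
    [SecondCountableTopology H] [MeasurableSpace H] [BorelSpace H] (x : ℕ → Ω → H) (n : ℕ) :
    StronglyMeasurable[history x n] (x n) := by
  refine Measurable.stronglyMeasurable ?_
  exact Measurable.mono (comap_measurable (x n))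
    (le_iSup₂ (f := fun j (_ : j ≤ n) => MeasurableSpace.comap (x j) inferInstance) n le_rfl) le_rfl

theorem history_le [MeasurableSpace H] {x : ℕ → Ω → H} (hx : ∀ n, Measurable (x n)) (n : ℕ) :
    history x n ≤ mΩ :=
  iSup₂_le fun j _ => (hx j).comap_le

/-- The histories of a measurable sequence, as a filtration. -/
def historyFiltration [MeasurableSpace H] {x : ℕ → Ω → H} (hx : ∀ n, Measurable (x n)) :
    Filtration ℕ mΩ where
  seq := history x
  mono' _ _ hnm := biSup_mono fun _ hj => hj.trans hnm
  le' := history_le hx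

variable [NormedAddCommGroup H]

/-- A Carathéodory integrand evaluated along a square-integrable random variable is integrable. -/
theorem IsCaratheodoryIntegrand.integrable [SecondCountableTopology H] [MeasurableSpace H]
    [BorelSpace H] {φ : Ω → H → ℝ} (hφ : IsCaratheodoryIntegrand μ φ) {y : Ω → H}
    (hy : MemLp y 2 μ) : Integrable (fun ω => φ ω (y ω)) μ := by
  -- Continuity holds only almost surely. Setting `φ` to zero off a measurable set of full measure
  -- gives continuity for every `ω`, hence joint measurability.
  obtain ⟨s, hs, hsm, hscont⟩ := hφ.continuous.exists_measurable_mem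
  have hmeas : Measurable (Function.uncurry fun v : H => s.indicator fun ω => φ ω v) := by
    refine measurable_uncurry_of_continuous_of_measurable (fun ω => ?_)
      fun v => (hφ.measurable v).indicator hsm
    by_cases hω : ω ∈ s
    · simpa [hω] using hscont ω hω
    · simpa [hω] using continuous_const
  have hae : AEMeasurable (fun ω => φ ω (y ω)) μ := by
    refine (hmeas.comp_aemeasurable (hy.1.aemeasurable.prodMk aemeasurable_id)).congr ?_
    filter_upwards [hs] with ω hω
    simp [hω]
  refine ⟨hae.aestronglyMeasurable, ?_⟩
  rw [hasFiniteIntegral_iff_ofReal (Eventually.of_forall fun ω => hφ.nonneg ω _)]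
  exact hφ.lintegral_lt_top y hy

variable [InnerProductSpace ℝ H] [MeasurableSpace H]

namespace IsStochasticIteration

variable {Z : Set H} {x : ℕ → Ω → H} {lam : ℕ → Ω → ℝ} {d : ℕ → Ω → H} {δ : ℕ → Ω → H → ℝ}
  (hx : IsStochasticIteration μ Z x lam d δ)
include hx

theorem memLp_smul (n : ℕ) : MemLp (fun ω => lam n ω • d n ω) 2 μ :=
  MemLp.smul (p := ∞) (hx.d_memLp n) (hx.lam_memLp n)

theorem memLp (n : ℕ) : MemLp (x n) 2 μ := by
  induction n with
  | zero => exact hx.init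
  | succ n ih => exact (memLp_congr_ae (hx.step n)).2 (ih.sub (hx.memLp_smul n))

theorem integrable_relax [IsProbabilityMeasure μ] (n : ℕ) :
    Integrable (fun ω => lam n ω * (2 - lam n ω) * ‖d n ω‖ ^ 2) μ := by
  have h1 : MemLp (fun ω => (2 : ℝ) - lam n ω) ∞ μ := (memLp_const 2).sub (hx.lam_memLp n)
  have h2 : MemLp (fun ω => lam n ω * (2 - lam n ω)) ∞ μ :=
    MemLp.mul (p := ∞) (q := ∞) h1 (hx.lam_memLp n)
  exact MemLp.integrable_mul (p := ∞) (q := 1) h2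
    (memLp_one_iff_integrable.2 (integrable_norm_sq (hx.d_memLp n)))

theorem integrable_cut (n : ℕ) {z : Ω → H} (hz : MemLp z 2 μ) :
    Integrable (fun ω => lam n ω * (inner ℝ (z ω + d n ω - x n ω) (d n ω) : ℝ)) μ := by
  refine (((hz.add (hx.d_memLp n)).sub (hx.memLp n)).integrable_inner (hx.memLp_smul n)).congr ?_
  exact Eventually.of_forall fun ω => by simp [inner_smul_right]

/-- Membership in `L²` gives measurability only up to a null set; completeness of `μ` removes this
restriction, so that the histories really are sub-σ-algebras. -/
theorem measurable [BorelSpace H] [μ.IsComplete] (n : ℕ) : Measurable (x n) := by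
  rw [← aemeasurable_iff_measurable (μ := μ)]
  exact (hx.memLp n).1.aemeasurable

/-- As `z` is known at time `n`, it can be pulled out of the conditional expectation. The result is
affine in `z ω`, with coefficients that do not depend on `z`. -/
theorem condExp_cut_eq [CompleteSpace H] [IsProbabilityMeasure μ] (n : ℕ) {z : Ω → H}
    (hz : MemLp z 2 μ) (hzm : AEStronglyMeasurable[history x n] z μ) :
    μ[fun ω => lam n ω * (inner ℝ (z ω + d n ω - x n ω) (d n ω) : ℝ) | history x n] =ᵐ[μ]
      fun ω => (inner ℝ (z ω) ((μ[fun ω => lam n ω • d n ω | history x n]) ω) : ℝ) +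
        (μ[fun ω => lam n ω * (inner ℝ (d n ω - x n ω) (d n ω) : ℝ) | history x n]) ω := by
  have hint : Integrable (fun ω => (inner ℝ (z ω) (lam n ω • d n ω) : ℝ)) μ :=
    hz.integrable_inner (hx.memLp_smul n)
  have hint' : Integrable (fun ω => lam n ω * (inner ℝ (d n ω - x n ω) (d n ω) : ℝ)) μ := by
    simpa using hx.integrable_cut n (z := fun _ => 0) (memLp_const 0)
  have hsplit : (fun ω => lam n ω * (inner ℝ (z ω + d n ω - x n ω) (d n ω) : ℝ)) =
      (fun ω => (inner ℝ (z ω) (lam n ω • d n ω) : ℝ)) +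
        fun ω => lam n ω * (inner ℝ (d n ω - x n ω) (d n ω) : ℝ) := by
    ext ω
    rw [Pi.add_apply, add_sub_assoc, inner_add_left, inner_smul_right, mul_add]
  have hpull := condExp_bilin_of_aestronglyMeasurable_left (innerSL ℝ) hzm
    (g := fun ω => lam n ω • d n ω) hint ((hx.memLp_smul n).integrable one_le_two)
  rw [hsplit]
  filter_upwards [condExp_add hint hint' (history x n), hpull] with ω h1 h2
  rw [h1, Pi.add_apply]
  congr 1

/-- Off one null set the bound holds on a countable dense subset of `Z`. For fixed `ω` both sides
are continuous in the point, so the bound passes to all of `Z` and `z ω` may be substituted. -/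
theorem condExp_cut_le [CompleteSpace H]
    [TopologicalSpace.SeparableSpace H] [IsProbabilityMeasure μ] (n : ℕ) {z : Ω → H}
    (hz : MemLp z 2 μ) (hzm : AEStronglyMeasurable[history x n] z μ) (hzZ : ∀ᵐ ω ∂μ, z ω ∈ Z) :
    ∀ᵐ ω ∂μ, (μ[fun ω => lam n ω * (inner ℝ (z ω + d n ω - x n ω) (d n ω) : ℝ) | history x n]) ω
      ≤ δ n ω (z ω) / 2 := by
  obtain ⟨D, hDZ, hDc, hD⟩ :=
    (TopologicalSpace.IsSeparable.of_separableSpace Z).exists_countable_dense_subset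
  have hall : ∀ᵐ ω ∂μ, ∀ w ∈ D,
      (inner ℝ w ((μ[fun ω => lam n ω • d n ω | history x n]) ω) : ℝ) +
        (μ[fun ω => lam n ω * (inner ℝ (d n ω - x n ω) (d n ω) : ℝ) | history x n]) ω ≤
          δ n ω w / 2 := by
    refine (ae_ball_iff hDc).2 fun w hw => ?_
    filter_upwards [hx.cut n w (hDZ hw), hx.condExp_cut_eq n (memLp_const w)
      aestronglyMeasurable_const] with ω h1 h2
    rwa [← h2]
  filter_upwards [hall, hx.condExp_cut_eq n hz hzm, hzZ, (hx.tolerance n).continuous]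
    with ω h1 h2 h3 h4
  rw [h2]
  have hcl : IsClosed {w : H | (inner ℝ w ((μ[fun ω => lam n ω • d n ω | history x n]) ω) : ℝ) +
      (μ[fun ω => lam n ω * (inner ℝ (d n ω - x n ω) (d n ω) : ℝ) | history x n]) ω ≤
        δ n ω w / 2} := isClosed_le (by fun_prop) (by fun_prop)
  exact hcl.closure_subset_iff.2 h1 (hD h3)

theorem integral_relax_nonneg [BorelSpace H] [IsProbabilityMeasure μ] [μ.IsComplete] (n : ℕ) :
    0 ≤ ∫ ω, lam n ω * (2 - lam n ω) * ‖d n ω‖ ^ 2 ∂μ := by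
  rw [← integral_condExp (history_le hx.measurable n)]
  exact integral_nonneg_of_ae (hx.relax n)

theorem ae_summable_tolerance [IsProbabilityMeasure μ] [BorelSpace H]
    [TopologicalSpace.SeparableSpace H] {z : H} (hsum : Summable fun n => ∫ ω, δ n ω z ∂μ) :
    ∀ᵐ ω ∂μ, Summable fun n => δ n ω z := by
  have := UniformSpace.secondCountable_of_separable H
  exact ae_summable_of_summable_integral
    (fun n => (hx.tolerance n).integrable (memLp_const z))
    (fun n => Eventually.of_forall fun ω => (hx.tolerance n).nonneg ω z) hsum

/-- Expand the square of `(x n - z) - λ d` and add and subtract `2λ‖d‖²`, which isolates the cut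
term. -/
theorem condExp_norm_sq_eq [IsProbabilityMeasure μ] [μ.IsComplete] [BorelSpace H]
    [TopologicalSpace.SeparableSpace H] (n : ℕ) {z : Ω → H}
    (hz : MemLp z 2 μ) (hzm : AEStronglyMeasurable[history x n] z μ) :
    μ[fun ω => ‖x (n + 1) ω - z ω‖ ^ 2 | history x n] =ᵐ[μ] fun ω =>
      ‖x n ω - z ω‖ ^ 2 - (μ[fun ω => lam n ω * (2 - lam n ω) * ‖d n ω‖ ^ 2 | history x n]) ω +
        2 * (μ[fun ω => lam n ω * (inner ℝ (z ω + d n ω - x n ω) (d n ω) : ℝ) |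
          history x n]) ω := by
  have := UniformSpace.secondCountable_of_separable H
  have hmle : history x n ≤ mΩ := history_le hx.measurable n
  have hA : Integrable (fun ω => ‖x n ω - z ω‖ ^ 2) μ := integrable_norm_sq ((hx.memLp n).sub hz)
  have hB := hx.integrable_relax n
  have hC := hx.integrable_cut n hz
  have hAm : AEStronglyMeasurable[history x n] (fun ω => ‖x n ω - z ω‖ ^ 2) μ :=
    (by fun_prop : Continuous fun w : H => ‖w‖ ^ 2).comp_aestronglyMeasurable
      ((stronglyMeasurable_history x n).aestronglyMeasurable.sub hzm)
  have hstep : (fun ω => ‖x (n + 1) ω - z ω‖ ^ 2) =ᵐ[μ]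
      (fun ω => ‖x n ω - z ω‖ ^ 2) - (fun ω => lam n ω * (2 - lam n ω) * ‖d n ω‖ ^ 2) +
        (2 : ℝ) • fun ω => lam n ω * (inner ℝ (z ω + d n ω - x n ω) (d n ω) : ℝ) := by
    filter_upwards [hx.step n] with ω hω
    simp only [Pi.add_apply, Pi.sub_apply, Pi.smul_apply, smul_eq_mul]
    have h1 : x (n + 1) ω - z ω = (x n ω - z ω) - lam n ω • d n ω := by rw [hω]; abel
    have h2 : z ω + d n ω - x n ω = d n ω - (x n ω - z ω) := by abel
    rw [h1, h2, norm_sub_sq_real, inner_smul_right, inner_sub_left (d n ω), norm_smul,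
      real_inner_self_eq_norm_sq, mul_pow, Real.norm_eq_abs, sq_abs]
    ring
  filter_upwards [condExp_congr_ae (m := history x n) hstep,
    condExp_add (hA.sub hB) (hC.smul (2 : ℝ)) (history x n),
    condExp_sub hA hB (history x n),
    condExp_smul (2 : ℝ) (fun ω => lam n ω * (inner ℝ (z ω + d n ω - x n ω) (d n ω) : ℝ))
      (history x n),
    condExp_of_aestronglyMeasurable' hmle hAm hA] with ω h1 h2 h3 h4 h5
  rw [h1, h2, Pi.add_apply, h3, h4, Pi.sub_apply, h5]
  rfl

end IsStochasticIteration

/-! ### Measurable choice of limits and the one-step inequalities. -/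

variable [CompleteSpace H] [TopologicalSpace.SeparableSpace H] [BorelSpace H]

/-- A family of almost sure weak limits in a nonempty set can be chosen measurably. -/
theorem exists_measurable_weaklyTendsto [μ.IsComplete] {Z : Set H} (hZ : Z.Nonempty)
    {x : ℕ → Ω → H} (hx : ∀ n, Measurable (x n))
    (h : ∀ᵐ ω ∂μ, ∃ y ∈ Z, WeaklyTendsto (fun n => x n ω) y) :
    ∃ y : Ω → H, Measurable y ∧ (∀ ω, y ω ∈ Z) ∧
      ∀ᵐ ω ∂μ, WeaklyTendsto (fun n => x n ω) (y ω) := by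
  classical
  obtain ⟨z₀, hz₀⟩ := hZ
  -- The default `z₀` where no limit exists keeps `y` in `Z` at every `ω`, not only almost surely.
  have hsel : ∀ ω, ∃ y ∈ Z, (∃ y' ∈ Z, WeaklyTendsto (fun n => x n ω) y') →
      WeaklyTendsto (fun n => x n ω) y := by
    intro ω
    by_cases hω : ∃ y' ∈ Z, WeaklyTendsto (fun n => x n ω) y'
    · exact ⟨hω.choose, hω.choose_spec.1, fun _ => hω.choose_spec.2⟩
    · exact ⟨z₀, hz₀, fun h' => absurd h' hω⟩
  choose y hyZ hy using hsel
  have hlim : ∀ᵐ ω ∂μ, WeaklyTendsto (fun n => x n ω) (y ω) := h.mono hy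
  refine ⟨y, measurable_of_forall_inner fun v => ?_, hyZ, hlim⟩
  rw [← aemeasurable_iff_measurable (μ := μ)]
  refine aemeasurable_of_tendsto_metrizable_ae (u := atTop)
    (f := fun n ω => (inner ℝ v (x n ω) : ℝ)) (fun n => ?_) ?_
  · exact (measurable_const.inner (hx n)).aemeasurable
  · filter_upwards [hlim] with ω hω using weaklyTendsto_iff_forall_inner.1 hω v

/-- A family of almost sure strong limits in a nonempty set can be chosen measurably. -/
theorem exists_measurable_tendsto [μ.IsComplete] {Z : Set H} (hZ : Z.Nonempty)
    {x : ℕ → Ω → H} (hx : ∀ n, Measurable (x n))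
    (h : ∀ᵐ ω ∂μ, ∃ y ∈ Z, Tendsto (fun n => x n ω) atTop (𝓝 y)) :
    ∃ y : Ω → H, Measurable y ∧ (∀ ω, y ω ∈ Z) ∧
      ∀ᵐ ω ∂μ, Tendsto (fun n => x n ω) atTop (𝓝 (y ω)) := by
  obtain ⟨y, hym, hyZ, hy⟩ := exists_measurable_weaklyTendsto hZ hx
    (h.mono fun ω ⟨y, hyZ, hy⟩ => ⟨y, hyZ, hy.weaklyTendsto⟩)
  refine ⟨y, hym, hyZ, ?_⟩
  filter_upwards [h, hy] with ω ⟨y', _, hy'⟩ hω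
  rwa [hω.unique hy'.weaklyTendsto]

namespace IsStochasticIteration

variable {Z : Set H} {x : ℕ → Ω → H} {lam : ℕ → Ω → ℝ} {d : ℕ → Ω → H} {δ : ℕ → Ω → H → ℝ}
  (hx : IsStochasticIteration μ Z x lam d δ)
include hx

theorem condExp_norm_sq_le [IsProbabilityMeasure μ] [μ.IsComplete] (n : ℕ) {z : Ω → H}
    (hz : MemLp z 2 μ) (hzm : AEStronglyMeasurable[history x n] z μ) (hzZ : ∀ᵐ ω ∂μ, z ω ∈ Z) :
    ∀ᵐ ω ∂μ, (μ[fun ω => ‖x (n + 1) ω - z ω‖ ^ 2 | history x n]) ω ≤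
      ‖x n ω - z ω‖ ^ 2 - (μ[fun ω => lam n ω * (2 - lam n ω) * ‖d n ω‖ ^ 2 | history x n]) ω +
        δ n ω (z ω) := by
  filter_upwards [hx.condExp_norm_sq_eq n hz hzm, hx.condExp_cut_le n hz hzm hzZ] with ω h1 h2
  rw [h1]
  linarith

theorem integral_norm_sq_le [IsProbabilityMeasure μ] [μ.IsComplete] (n : ℕ) {z : Ω → H}
    (hz : MemLp z 2 μ) (hzm : AEStronglyMeasurable[history x n] z μ) (hzZ : ∀ᵐ ω ∂μ, z ω ∈ Z) :
    ∫ ω, ‖x (n + 1) ω - z ω‖ ^ 2 ∂μ ≤ ∫ ω, ‖x n ω - z ω‖ ^ 2 ∂μ -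
      ∫ ω, lam n ω * (2 - lam n ω) * ‖d n ω‖ ^ 2 ∂μ + ∫ ω, δ n ω (z ω) ∂μ := by
  have := UniformSpace.secondCountable_of_separable H
  have hmle : history x n ≤ mΩ := history_le hx.measurable n
  have hA : Integrable (fun ω => ‖x n ω - z ω‖ ^ 2) μ := integrable_norm_sq ((hx.memLp n).sub hz)
  have hB : Integrable
      (μ[fun ω => lam n ω * (2 - lam n ω) * ‖d n ω‖ ^ 2 | history x n]) μ := integrable_condExp
  have hD := (hx.tolerance n).integrable hz
  have h := integral_mono_ae integrable_condExp ((hA.sub hB).add hD)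
    (hx.condExp_norm_sq_le n hz hzm hzZ)
  simp only [Pi.add_apply, Pi.sub_apply] at h
  rwa [integral_condExp hmle, integral_add (by exact hA.sub hB) hD, integral_sub hA hB,
    integral_condExp hmle] at h

end IsStochasticIteration
end Iteration

/-! ### Asymptotic behaviour of the iterates. -/

namespace IsStochasticIteration

variable {Ω : Type*} {mΩ : MeasurableSpace Ω} {μ : Measure Ω} [IsProbabilityMeasure μ]
  [μ.IsComplete] {H : Type*} [NormedAddCommGroup H] [InnerProductSpace ℝ H]
  [TopologicalSpace.SeparableSpace H] [MeasurableSpace H] [BorelSpace H]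
  {Z : Set H} {x : ℕ → Ω → H} {lam : ℕ → Ω → ℝ} {d : ℕ → Ω → H} {δ : ℕ → Ω → H → ℝ}
  (hx : IsStochasticIteration μ Z x lam d δ)
include hx

/-- Robbins–Siegmund needs errors adapted to the histories, whereas `δ n` is only `ℱ`-measurable.
The error used is therefore the positive part of twice the conditional cut term, which is adapted
and lies below `δ n`. -/
theorem ae_tendsto_and_summable {z : H} (hz : z ∈ Z)
    (hsum : ∀ᵐ ω ∂μ, Summable fun n => δ n ω z) :
    ∀ᵐ ω ∂μ, (∃ l : ℝ, Tendsto (fun n => ‖x n ω - z‖) atTop (𝓝 l)) ∧ Summable fun n =>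
      (μ[fun ω' => lam n ω' * (2 - lam n ω') * ‖d n ω'‖ ^ 2 | history x n]) ω := by
  have := UniformSpace.secondCountable_of_separable H
  have hz2 : MemLp (fun _ : Ω => z) 2 μ := memLp_const z
  set Y : ℕ → Ω → ℝ := fun n =>
    μ[fun ω => lam n ω * (inner ℝ (z + d n ω - x n ω) (d n ω) : ℝ) | history x n] with hY
  have hrs := ae_tendsto_and_summable_of_condExp_le (historyFiltration hx.measurable)
    (V := fun n ω => ‖x n ω - z‖ ^ 2)
    (θ := fun n => μ[fun ω => lam n ω * (2 - lam n ω) * ‖d n ω‖ ^ 2 | history x n])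
    (ε := fun n ω => max (2 * Y n ω) 0)
    (fun n => (by fun_prop : Continuous fun w : H => ‖w - z‖ ^ 2).comp_stronglyMeasurable
      (stronglyMeasurable_history x n))
    (fun n => integrable_norm_sq ((hx.memLp n).sub hz2)) (fun n ω => sq_nonneg _)
    (fun n => integrable_condExp) (fun n => hx.relax n)
    (fun n => (by fun_prop : Continuous fun t : ℝ => max (2 * t) 0).comp_stronglyMeasurable
      stronglyMeasurable_condExp)
    (fun n ω => le_max_right _ _) ?_ ?_
  · filter_upwards [hrs] with ω ⟨⟨l, hl⟩, hθ⟩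
    refine ⟨⟨Real.sqrt l, ?_⟩, hθ⟩
    refine ((Real.continuous_sqrt.tendsto l).comp hl).congr fun n => ?_
    simp
  · intro n
    filter_upwards [hx.condExp_norm_sq_eq n hz2 aestronglyMeasurable_const] with ω hω
    refine hω.le.trans ?_
    gcongr
    exact le_max_left _ _
  · filter_upwards [hsum, ae_all_iff.2 fun n => hx.cut n z hz] with ω h1 h2
    refine Summable.of_nonneg_of_le (fun n => le_max_right _ _) (fun n => ?_) h1
    refine max_le ?_ ((hx.tolerance n).nonneg _ _)
    have h3 : Y n ω ≤ δ n ω z / 2 := h2 n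
    linarith

/-- The quantifier over `z` stands inside the almost sure one, so that random points, and cluster
points depending on `ω`, may be substituted. -/
theorem ae_forall_exists_tendsto (hsum : ∀ z ∈ Z, ∀ᵐ ω ∂μ, Summable fun n => δ n ω z) :
    ∀ᵐ ω ∂μ, ∀ z ∈ Z, ∃ l : ℝ, Tendsto (fun n => ‖x n ω - z‖) atTop (𝓝 l) := by
  obtain ⟨D, hDZ, hDc, hD⟩ :=
    (TopologicalSpace.IsSeparable.of_separableSpace Z).exists_countable_dense_subset
  have hall : ∀ᵐ ω ∂μ, ∀ z ∈ D, ∃ l : ℝ, Tendsto (fun n => ‖x n ω - z‖) atTop (𝓝 l) := by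
    refine (ae_ball_iff hDc).2 fun w hw => ?_
    exact (hx.ae_tendsto_and_summable (hDZ hw) (hsum w (hDZ hw))).mono fun ω hω => hω.1
  filter_upwards [hall] with ω hω z hz
  exact exists_tendsto_norm_sub_of_mem_closure hω (hD hz)

theorem ae_bounded (hZ : Z.Nonempty) (hsum : ∀ z ∈ Z, ∀ᵐ ω ∂μ, Summable fun n => δ n ω z) :
    ∀ᵐ ω ∂μ, ∃ C : ℝ, ∀ n, ‖x n ω‖ ≤ C := by
  obtain ⟨z, hz⟩ := hZ
  filter_upwards [hx.ae_forall_exists_tendsto hsum] with ω hω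
  obtain ⟨l, hl⟩ := hω z hz
  obtain ⟨C, hC⟩ := hl.bddAbove_range
  refine ⟨C + ‖z‖, fun n => ?_⟩
  have h1 : ‖x n ω - z‖ ≤ C := hC ⟨n, rfl⟩
  have h2 := norm_le_norm_sub_add (x n ω) z
  linarith

theorem exists_weak_limit [CompleteSpace H] (hZ : Z.Nonempty)
    (hsum : ∀ z ∈ Z, ∀ᵐ ω ∂μ, Summable fun n => δ n ω z)
    (hcl : ∀ᵐ ω ∂μ, weakClusterPts (fun n => x n ω) ⊆ Z) :
    ∃ y : Ω → H, Measurable y ∧ (∀ ω, y ω ∈ Z) ∧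
      ∀ᵐ ω ∂μ, WeaklyTendsto (fun n => x n ω) (y ω) := by
  refine exists_measurable_weaklyTendsto hZ hx.measurable ?_
  filter_upwards [hx.ae_bounded hZ hsum, hx.ae_forall_exists_tendsto hsum, hcl] with ω ⟨C, hC⟩ h1 h2
  exact exists_weaklyTendsto_of_weakClusterPts_subset hC h1 h2

theorem exists_strong_limit [CompleteSpace H] (hZ : Z.Nonempty)
    (hsum : ∀ z ∈ Z, ∀ᵐ ω ∂μ, Summable fun n => δ n ω z)
    (hcl : ∀ᵐ ω ∂μ, (strongClusterPts (fun n => x n ω) ∩ Z).Nonempty) :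
    ∃ y : Ω → H, Measurable y ∧ (∀ ω, y ω ∈ Z) ∧
      ∀ᵐ ω ∂μ, Tendsto (fun n => x n ω) atTop (𝓝 (y ω)) := by
  refine exists_measurable_tendsto hZ hx.measurable ?_
  filter_upwards [hx.ae_forall_exists_tendsto hsum, hcl] with ω h1 ⟨y, hy, hyZ⟩
  exact ⟨y, hyZ, tendsto_of_mem_strongClusterPts hy (h1 y hyZ)⟩

variable [CompleteSpace H]

/-- Telescoping the integrated inequality. Both summands on the left are nonnegative, so this one
bound yields the `L²` bound and the summability of the relaxation terms. -/
theorem integral_norm_sq_add_sum_le {z : H} (hz : z ∈ Z)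
    (hsum : Summable fun n => ∫ ω, δ n ω z ∂μ) (n : ℕ) :
    ∫ ω, ‖x n ω - z‖ ^ 2 ∂μ +
        ∑ k ∈ Finset.range n, ∫ ω, lam k ω * (2 - lam k ω) * ‖d k ω‖ ^ 2 ∂μ ≤
      ∫ ω, ‖x 0 ω - z‖ ^ 2 ∂μ + ∑' k, ∫ ω, δ k ω z ∂μ := by
  have hδ0 : ∀ k, 0 ≤ ∫ ω, δ k ω z ∂μ := fun k =>
    integral_nonneg fun ω => (hx.tolerance k).nonneg ω z
  have h : ∫ ω, ‖x n ω - z‖ ^ 2 ∂μ +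
        ∑ k ∈ Finset.range n, ∫ ω, lam k ω * (2 - lam k ω) * ‖d k ω‖ ^ 2 ∂μ ≤
      ∫ ω, ‖x 0 ω - z‖ ^ 2 ∂μ + ∑ k ∈ Finset.range n, ∫ ω, δ k ω z ∂μ := by
    induction n with
    | zero => simp
    | succ n ih =>
      have := hx.integral_norm_sq_le n (z := fun _ => z) (memLp_const z)
        aestronglyMeasurable_const (Eventually.of_forall fun _ => hz)
      rw [Finset.sum_range_succ, Finset.sum_range_succ]
      linarith
  exact h.trans (by gcongr; exact hsum.sum_le_tsum _ fun k _ => hδ0 k)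

theorem summable_integral_relax (hZ : Z.Nonempty)
    (hsum : ∀ z ∈ Z, Summable fun n => ∫ ω, δ n ω z ∂μ) :
    Summable fun n => ∫ ω, lam n ω * (2 - lam n ω) * ‖d n ω‖ ^ 2 ∂μ := by
  obtain ⟨z, hz⟩ := hZ
  refine summable_of_sum_range_le
    (c := ∫ ω, ‖x 0 ω - z‖ ^ 2 ∂μ + ∑' k, ∫ ω, δ k ω z ∂μ) hx.integral_relax_nonneg fun n => ?_
  refine le_trans ?_ (hx.integral_norm_sq_add_sum_le hz (hsum z hz) n)
  exact le_add_of_nonneg_left (integral_nonneg fun ω => sq_nonneg _)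

theorem exists_eLpNorm_two_le (hZ : Z.Nonempty)
    (hsum : ∀ z ∈ Z, Summable fun n => ∫ ω, δ n ω z ∂μ) :
    ∃ C : ℝ, 0 ≤ C ∧ ∀ n, eLpNorm (x n) 2 μ ≤ ENNReal.ofReal C := by
  obtain ⟨z, hz⟩ := hZ
  have hz2 : MemLp (fun _ : Ω => z) 2 μ := memLp_const z
  refine ⟨Real.sqrt (∫ ω, ‖x 0 ω - z‖ ^ 2 ∂μ + ∑' k, ∫ ω, δ k ω z ∂μ) +
    (eLpNorm (fun _ : Ω => z) 2 μ).toReal, by positivity, fun n => ?_⟩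
  have hsub : MemLp (fun ω => x n ω - z) 2 μ := (hx.memLp n).sub hz2
  have h1 : (eLpNorm (fun ω => x n ω - z) 2 μ).toReal ≤
      Real.sqrt (∫ ω, ‖x 0 ω - z‖ ^ 2 ∂μ + ∑' k, ∫ ω, δ k ω z ∂μ) := by
    refine Real.le_sqrt_of_sq_le ?_
    rw [sq_toReal_eLpNorm_two hsub]
    refine le_trans ?_ (hx.integral_norm_sq_add_sum_le hz (hsum z hz) n)
    exact le_add_of_nonneg_right (Finset.sum_nonneg fun k _ => hx.integral_relax_nonneg k)
  have h2 : eLpNorm (x n) 2 μ ≤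
      eLpNorm (fun ω => x n ω - z) 2 μ + eLpNorm (fun _ : Ω => z) 2 μ := by
    have h3 := eLpNorm_add_le hsub.1 hz2.1 one_le_two
    have h4 : (fun ω => x n ω - z) + (fun _ => z) = x n := by ext ω; simp
    rwa [h4] at h3
  refine h2.trans ?_
  rw [ENNReal.ofReal_add (by positivity) (by positivity), ENNReal.ofReal_toReal hz2.2.ne]
  gcongr
  rw [← ENNReal.ofReal_toReal hsub.2.ne]
  exact ENNReal.ofReal_le_ofReal h1

/-- A general random `z` is not known at time `n`, so no conditional inequality applies to it. The
distances converge pathwise instead, and the `L²` bound allows passage to the limit in their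
integrals. -/
theorem exists_tendsto_eLpNorm_one (hZ : Z.Nonempty)
    (hsum : ∀ z ∈ Z, Summable fun n => ∫ ω, δ n ω z ∂μ) {z : Ω → H} (hz : MemLp z 2 μ)
    (hzZ : ∀ᵐ ω ∂μ, z ω ∈ Z) :
    ∃ l : ℝ, Tendsto (fun n => (eLpNorm (fun ω => x n ω - z ω) 1 μ).toReal) atTop (𝓝 l) := by
  obtain ⟨C, hC0, hC⟩ := hx.exists_eLpNorm_two_le hZ hsum
  have hsub : ∀ n, MemLp (fun ω => x n ω - z ω) 2 μ := fun n => (hx.memLp n).sub hz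
  have hbd : ∀ n, eLpNorm (fun ω => x n ω - z ω) 2 μ ≤
      ENNReal.ofReal (C + (eLpNorm z 2 μ).toReal) := fun n => by
    refine (eLpNorm_sub_le (hx.memLp n).1 hz.1 one_le_two).trans ?_
    rw [ENNReal.ofReal_add hC0 ENNReal.toReal_nonneg, ENNReal.ofReal_toReal hz.2.ne]
    gcongr
    exact hC n
  have hconv : ∀ᵐ ω ∂μ, ∃ l : ℝ, Tendsto (fun n => ‖x n ω - z ω‖) atTop (𝓝 l) := by
    filter_upwards [hzZ, hx.ae_forall_exists_tendsto fun z hz =>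
      hx.ae_summable_tolerance (hsum z hz)] with ω h1 h2 using h2 _ h1
  obtain ⟨h, hm, hlim⟩ := measurable_limit_of_tendsto_metrizable_ae
    (fun n => (hsub n).1.norm.aemeasurable) hconv
  have hh : MemLp h 2 μ := by
    refine memLp_two_of_enorm_le_liminf (fun n => (hsub n).1.norm)
      (fun n => (eLpNorm_norm _).trans_le (hbd n)) hm.aestronglyMeasurable ?_
    filter_upwards [hlim] with ω hω using hω.enorm.liminf_eq.ge
  refine ⟨∫ ω, h ω ∂μ, ?_⟩
  have hkey := tendsto_integral_of_norm_le_mul (fun n => (hsub n).1) hbd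
    (memLp_const (1 : ℝ)) (f := fun n ω => ‖x n ω - z ω‖)
    (fun n => Eventually.of_forall fun ω => by simp)
    (fun n => ((hsub n).integrable one_le_two).norm) (hh.integrable one_le_two) hlim
  refine hkey.congr fun n => ?_
  rw [integral_norm_eq_lintegral_enorm (hsub n).1, eLpNorm_one_eq_lintegral_enorm]

/-- Forward is Vitali. Conversely, `L¹` convergence gives an almost surely convergent subsequence,
so `y ω` is a strong cluster point in `Z`; convergence of the distances to it upgrades this to the
full sequence. -/
theorem ae_tendsto_iff_tendsto_eLpNorm_one (hZ : Z.Nonempty)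
    (hsum : ∀ z ∈ Z, Summable fun n => ∫ ω, δ n ω z ∂μ) {y : Ω → H} (hy : Measurable y)
    (hyZ : ∀ᵐ ω ∂μ, y ω ∈ Z) :
    (∀ᵐ ω ∂μ, Tendsto (fun n => x n ω) atTop (𝓝 (y ω))) ↔
      (MemLp y 1 μ ∧ Tendsto (fun n => eLpNorm (fun ω => x n ω - y ω) 1 μ) atTop (𝓝 0)) := by
  have := UniformSpace.secondCountable_of_separable H
  obtain ⟨C, hC0, hC⟩ := hx.exists_eLpNorm_two_le hZ hsum
  constructor
  · intro h
    have hy2 : MemLp y 2 μ := memLp_two_of_enorm_le_liminf (fun n => (hx.memLp n).1) hC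
      hy.aestronglyMeasurable (h.mono fun ω hω => hω.enorm.liminf_eq.ge)
    have hy1 : MemLp y 1 μ := hy2.mono_exponent one_le_two
    refine ⟨hy1, tendsto_Lp_finite_of_tendsto_ae le_rfl ENNReal.one_ne_top
      (fun n => (hx.memLp n).1) hy1 ?_ h⟩
    exact unifIntegrable_one_of_norm_le_mul (fun n => (hx.memLp n).1) hC (memLp_const (1 : ℝ))
      fun n => Eventually.of_forall fun ω => by simp
  · rintro ⟨hy1, h⟩
    obtain ⟨k, hk, hkt⟩ := (tendstoInMeasure_of_tendsto_eLpNorm one_ne_zero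
      (fun n => (hx.memLp n).1) hy1.1 h).exists_seq_tendsto_ae
    filter_upwards [hkt, hyZ, hx.ae_forall_exists_tendsto fun z hz =>
      hx.ae_summable_tolerance (hsum z hz)] with ω h1 h2 h3
    exact tendsto_of_mem_strongClusterPts ⟨k, hk, h1⟩ (h3 _ h2)

end IsStochasticIteration

/-! ### The main theorem. -/

theorem theorem3p1
    {Ω : Type*} [mΩ : MeasurableSpace Ω] (μ : Measure Ω) [IsProbabilityMeasure μ] [μ.IsComplete]
    {H : Type*} [NormedAddCommGroup H] [InnerProductSpace ℝ H] [CompleteSpace H]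
    [TopologicalSpace.SeparableSpace H] [MeasurableSpace H] [BorelSpace H]
    (Z : Set H) (hZne : Z.Nonempty) (hZcl : IsClosed Z)
    (x : ℕ → Ω → H) (lam : ℕ → Ω → ℝ) (d : ℕ → Ω → H) (δ : ℕ → Ω → H → ℝ)
    (hx : IsStochasticIteration μ Z x lam d δ) :
    -- the sequence is well defined in `L²`
    ∃ hL2 : ∀ n, MemLp (x n) 2 μ,
    (∀ n, history x n ≤ mΩ ∧
      Integrable (fun ω => lam n ω * (2 - lam n ω) * ‖d n ω‖ ^ 2) μ ∧
      ∀ z ∈ Z, Integrable (fun ω => lam n ω * inner ℝ (z + d n ω - x n ω) (d n ω)) μ) ∧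
    -- conditional inequality for deterministic points
    (∀ n, ∀ z ∈ Z, ∀ᵐ ω ∂μ,
      (μ[fun ω' => ‖x (n + 1) ω' - z‖ ^ 2 | history x n]) ω ≤
        ‖x n ω - z‖ ^ 2
          - (μ[fun ω' => lam n ω' * (2 - lam n ω') * ‖d n ω'‖ ^ 2 | history x n]) ω
          + δ n ω z) ∧
    -- conditional inequality for random points
    (∀ n, ∀ z : Ω → H, MemLp z 2 μ → AEStronglyMeasurable[history x n] z μ →
      (∀ᵐ ω ∂μ, z ω ∈ Z) → ∀ᵐ ω ∂μ,
      (μ[fun ω' => ‖x (n + 1) ω' - z ω'‖ ^ 2 | history x n]) ω ≤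
        ‖x n ω - z ω‖ ^ 2
          - (μ[fun ω' => lam n ω' * (2 - lam n ω') * ‖d n ω'‖ ^ 2 | history x n]) ω
          + δ n ω (z ω)) ∧
    -- inequality in `L²`
    (∀ n, ∀ z : Ω → H, MemLp z 2 μ → AEStronglyMeasurable[history x n] z μ →
      (∀ᵐ ω ∂μ, z ω ∈ Z) →
      Integrable (fun ω => δ n ω (z ω)) μ ∧
      (eLpNorm (fun ω => x (n + 1) ω - z ω) 2 μ).toReal ^ 2 ≤
        (eLpNorm (fun ω => x n ω - z ω) 2 μ).toReal ^ 2
          - ∫ ω, lam n ω * (2 - lam n ω) * ‖d n ω‖ ^ 2 ∂μ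
          + ∫ ω, δ n ω (z ω) ∂μ) ∧
    -- almost surely summable tolerances
    ((∀ z ∈ Z, ∀ᵐ ω ∂μ, Summable (fun n => δ n ω z)) →
      (∀ᵐ ω ∂μ, ∃ C : ℝ, ∀ n, ‖x n ω‖ ≤ C) ∧
      (∀ z : Ω → H, Measurable z → (∀ᵐ ω ∂μ, z ω ∈ Z) →
        ∀ᵐ ω ∂μ, ∃ l : ℝ, Tendsto (fun n => ‖x n ω - z ω‖) atTop (𝓝 l)) ∧
      (∀ᵐ ω ∂μ, Summable (fun n =>
        (μ[fun ω' => lam n ω' * (2 - lam n ω') * ‖d n ω'‖ ^ 2 | history x n]) ω)) ∧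
      ((∀ᵐ ω ∂μ, weakClusterPts (fun n => x n ω) ⊆ Z) →
        ∃ y : Ω → H, Measurable y ∧ (∀ ω, y ω ∈ Z) ∧
          ∀ᵐ ω ∂μ, WeaklyTendsto (fun n => x n ω) (y ω)) ∧
      ((∀ᵐ ω ∂μ, (strongClusterPts (fun n => x n ω) ∩ Z).Nonempty) →
        ∃ y : Ω → H, Measurable y ∧ (∀ ω, y ω ∈ Z) ∧
          ∀ᵐ ω ∂μ, Tendsto (fun n => x n ω) atTop (𝓝 (y ω))) ∧
      ((∀ᵐ ω ∂μ, (strongClusterPts (fun n => x n ω)).Nonempty) →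
        (∀ᵐ ω ∂μ, weakClusterPts (fun n => x n ω) ⊆ Z) →
        ∃ y : Ω → H, Measurable y ∧ (∀ ω, y ω ∈ Z) ∧
          ∀ᵐ ω ∂μ, Tendsto (fun n => x n ω) atTop (𝓝 (y ω)))) ∧
    -- tolerances with summable expectations
    ((∀ z ∈ Z, Summable (fun n => ∫ ω, δ n ω z ∂μ)) →
      (∃ C : ℝ, ∀ n, (eLpNorm (x n) 2 μ).toReal ≤ C) ∧
      (∀ z : Ω → H, MemLp z 2 μ → (∀ᵐ ω ∂μ, z ω ∈ Z) →
        ∃ l : ℝ, Tendsto (fun n => (eLpNorm (fun ω => x n ω - z ω) 1 μ).toReal) atTop (𝓝 l)) ∧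
      Summable (fun n => ∫ ω, lam n ω * (2 - lam n ω) * ‖d n ω‖ ^ 2 ∂μ) ∧
      (∀ y : Ω → H, Measurable y → (∀ᵐ ω ∂μ, WeaklyTendsto (fun n => x n ω) (y ω)) →
        ∃ hy : MemLp y 2 μ, WeaklyTendsto (fun n => (hL2 n).toLp (x n)) (hy.toLp y)) ∧
      (∀ y : Ω → H, Measurable y → (∀ᵐ ω ∂μ, y ω ∈ Z) →
        ((∀ᵐ ω ∂μ, Tendsto (fun n => x n ω) atTop (𝓝 (y ω))) ↔
          (MemLp y 1 μ ∧ Tendsto (fun n => eLpNorm (fun ω => x n ω - y ω) 1 μ) atTop (𝓝 0))) ∧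
        ((∀ᵐ ω ∂μ, Tendsto (fun n => x n ω) atTop (𝓝 (y ω))) →
          ∃ hy : MemLp y 2 μ, WeaklyTendsto (fun n => (hL2 n).toLp (x n)) (hy.toLp y)))) := by
  have := UniformSpace.secondCountable_of_separable H
  refine ⟨hx.memLp, fun n => ⟨history_le hx.measurable n, hx.integrable_relax n,
    fun z _ => hx.integrable_cut n (memLp_const z)⟩, fun n z hz => ?_, fun n z => ?_,
    fun n z hz hzm hzZ => ⟨(hx.tolerance n).integrable hz, ?_⟩, fun hsum => ?_, fun hsum => ?_⟩
  · exact hx.condExp_norm_sq_le n (memLp_const z) aestronglyMeasurable_const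
      (Eventually.of_forall fun _ => hz)
  · exact hx.condExp_norm_sq_le n
  · have hsub : ∀ k, MemLp (fun ω => x k ω - z ω) 2 μ := fun k => (hx.memLp k).sub hz
    rw [sq_toReal_eLpNorm_two (hsub (n + 1)), sq_toReal_eLpNorm_two (hsub n)]
    exact hx.integral_norm_sq_le n hz hzm hzZ
  · refine ⟨hx.ae_bounded hZne hsum, fun z _ hzZ => ?_, ?_, hx.exists_weak_limit hZne hsum,
      hx.exists_strong_limit hZne hsum, fun hs hw => hx.exists_strong_limit hZne hsum ?_⟩
    · filter_upwards [hzZ, hx.ae_forall_exists_tendsto hsum] with ω h1 h2 using h2 _ h1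
    · obtain ⟨z, hz⟩ := hZne
      exact (hx.ae_tendsto_and_summable hz (hsum z hz)).mono fun ω hω => hω.2
    -- A strong cluster point is a weak one, hence lies in `Z`; this reduces to the previous strong
    -- convergence criterion.
    · filter_upwards [hs, hw] with ω ⟨y, k, hk, hy⟩ h2
      exact ⟨y, ⟨k, hk, hy⟩, h2 ⟨k, hk, hy.weaklyTendsto⟩⟩
  · obtain ⟨C, hC0, hC⟩ := hx.exists_eLpNorm_two_le hZne hsum
    refine ⟨⟨C, fun n => ENNReal.toReal_le_of_le_ofReal hC0 (hC n)⟩,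
      fun z hz hzZ => hx.exists_tendsto_eLpNorm_one hZne hsum hz hzZ,
      hx.summable_integral_relax hZne hsum,
      fun y hy => exists_memLp_weaklyTendsto_toLp hx.memLp hC hy.aestronglyMeasurable,
      fun y hy hyZ => ⟨hx.ae_tendsto_iff_tendsto_eLpNorm_one hZne hsum hy hyZ, fun h => ?_⟩⟩
    exact exists_memLp_weaklyTendsto_toLp hx.memLp hC hy.aestronglyMeasurable
      (h.mono fun ω hω => hω.weaklyTendsto)
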